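/- Let $(\Omega,\mathcal F,P)$ be a probability space and let $X_1,X_2,\dots$ be i.i.d. random variables in $L^\infty(P)$, with $S_n=\sum_{i=1}^n X_i$ and $\sigma=\sqrt{\mathrm{Var}[X_1]}$. For a real random variable $X$ let $q_X(t)=\inf\{m\in\mathbb R : P[X\le m]\ge t\}$ (with $\inf\emptyset=\infty$) and, for $\lambda\in(0,1]$, $U_\lambda(X)=\frac1\lambda\int_0^\lambda q_X(t)\,dt$. Let $\mu$ be a probability measure on $(0,1]$ with $\int\log(1/\lambda)\,\mu(d\lambda)<\infty$, and put $U_\mu(X)=\int U_\lambda(X)\,\mu(d\lambda)$. Let $u:\mathbb R\to\mathbb R$ be continuously differentiable and strictly increasing with continuously differentiable inverse $u^{-1}:u(\mathbb R)\to\mathbb R$, and put $V_\mu(X)=u^{-1}\bigl(U_\mu(u(X))\bigr)$ for $X\in L^\infty(P)$. Then, for a standard normal random variable $Z$ (on any probability space) with density $\phi$ and distribution function $\Phi$, $$\lim_{n\to\infty}\sqrt n\,\bigl(E[X_1]-V_\mu(S_n/n)\bigr)=-\sigma\,U_\mu(Z)=-\sigma\int U_\lambda(Z)\,\mu(d\lambda)=\sigma\int\frac1\lambda\,\phi\bigl(\Phi^{-1}(\lambda)\bigr)\,\mu(d\lambda),$$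 where $\phi(\Phi^{-1}(1))=\phi(\infty)=0$ and both integrals with respect to $\mu$ are finite. In particular, the limit does not depend on $u$. -/

import Mathlib

open MeasureTheory ProbabilityTheory Filter Topology

noncomputable section

namespace RiskPremium

/-- The (left-continuous) quantile function `q_X(t) = inf {m ∈ ℝ | P[X ≤ m] ≥ t}`, taken in the
extended reals, so that `inf ∅ = ∞` (and `q_X(0) = -∞`). -/
def quantile {Ω : Type*} [MeasurableSpace Ω] (P : Measure Ω) (X : Ω → ℝ) (t : ℝ) : EReal :=
  sInf ((fun m : ℝ => (m : EReal)) '' {m : ℝ | t ≤ P.real {ω | X ω ≤ m}})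

/-- The building block `U_l(X) = (1/l) ∫₀ˡ q_X(t) dt` for `l ∈ (0, 1]`. The quantile is finite for
every `t ∈ (0, 1)`, so passing to real values changes the integrand at most at `t = 0, 1`. -/
def avarUtility {Ω : Type*} [MeasurableSpace Ω] (P : Measure Ω) (l : ℝ) (X : Ω → ℝ) : ℝ :=
  1 / l * ∫ t in (0 : ℝ)..l, (quantile P X t).toReal

/-- The mixture `U_μ(X) = ∫ U_l(X) μ(dl)`, for `μ` a probability measure concentrated on
`(0, 1]`. -/
def mixedUtility {Ω : Type*} [MeasurableSpace Ω] (P : Measure Ω) (μ : Measure ℝ) (X : Ω → ℝ) : ℝ :=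
  ∫ l, avarUtility P l X ∂μ

/-- The certainty equivalent `V_μ(X) = u⁻¹(U_μ(u(X)))`, where `u⁻¹` is the inverse of an injective
`u` on the range of `u`. -/
def certaintyEquivalent {Ω : Type*} [MeasurableSpace Ω] (P : Measure Ω) (μ : Measure ℝ)
    (u : ℝ → ℝ) (X : Ω → ℝ) : ℝ :=
  Function.invFun u (mixedUtility P μ (fun ω => u (X ω)))

/-- The standard normal distribution function `Φ` on `[-∞, ∞]`, with `Φ(-∞) = 0`, `Φ(∞) = 1`. -/
def stdNormalCDF (x : EReal) : ℝ :=
  (gaussianReal 0 1).real {y : ℝ | (y : EReal) ≤ x}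

/-- The inverse `Φ⁻¹ : [0, 1] → [-∞, ∞]` of `Φ`; in particular `Φ⁻¹(1) = ∞`. -/
def stdNormalInv (t : ℝ) : EReal :=
  Function.invFun stdNormalCDF t

/-- The standard normal density `φ`, with `φ(-∞) = φ(∞) = 0`. -/
def stdNormalPDF (x : EReal) : ℝ :=
  if x = ⊥ ∨ x = ⊤ then 0 else gaussianPDFReal 0 1 x.toReal

end RiskPremium

end

/-!
Write `Y n = (S_n - n E[X_1]) / √n`, `m = E[X_1]` and `q_Y` for the quantile function of `Y`. Since
quantiles commute with continuous monotone maps, `q_{u(S_n / n)} = u (m + q_{Y n} / √n)`, and hence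

`√n (U_μ(u(S_n / n)) - u(m)) = ∫ 1/l ∫₀ˡ √n (u(m + q_{Y n}(t) / √n) - u(m)) dt μ(dl)`.

By the central limit theorem `q_{Y n}(t) → σ q_Z(t)` for every `t ∈ (0, 1)`
(`tendsto_realQuantile`), so the integrand converges to `u'(m) σ q_Z(t)`. To dominate it, `u` is
Lipschitz on a compact interval that contains all the quantiles involved, and the `Y n` have
uniformly bounded exponential moments by Hoeffding's lemma, so that
`|q_{Y n}(t)| ≤ K - log t - log (1 - t)`. The average of this envelope over `(0, l)` is at most
`K + 2 + log (1 / l)` (`average_log_envelope_le`), which is where the assumption on `μ` enters.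
Dominated convergence therefore gives the first-order expansion of `U_μ(u(S_n / n))`
(`tendsto_mixedUtility_mean`), and differentiability of `u⁻¹` at `u(m)`, with derivative
`1 / u'(m)`, cancels the factor `u'(m)`.

The closed form of `U_l(Z)` (`avarUtility_normal`) follows from transporting Lebesgue measure on
`(0, 1)` by `q_Z` to the normal law.

The quantile function is handled throughout via the equivalence `q_X(t) ≤ m ↔ t ≤ P[X ≤ m]` for
`t ∈ (0, 1)` (`realQuantile_le_iff`).
-/

namespace RiskPremium

/-! ### Quantile functions -/

section Quantile

variable {Ω : Type*} [MeasurableSpace Ω] {P : Measure Ω} [IsProbabilityMeasure P] {X : Ω → ℝ}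

/-- The real-valued version of the quantile function, which is the one that `avarUtility`
integrates. It is only meaningful for levels in `(0, 1)`; elsewhere the value is junk. -/
noncomputable def realQuantile {Ω : Type*} [MeasurableSpace Ω] (P : Measure Ω) (X : Ω → ℝ)
    (t : ℝ) : ℝ :=
  (quantile P X t).toReal

lemma real_setOf_le_eq_cdf (hX : AEMeasurable X P) (m : ℝ) :
    P.real {ω | X ω ≤ m} = cdf (P.map X) m := by
  have := Measure.isProbabilityMeasure_map hX
  rw [cdf_eq_real, map_measureReal_apply_of_aemeasurable hX measurableSet_Iic]
  rfl

lemma exists_quantile_eq_coe (hX : AEMeasurable X P) {t : ℝ} (ht : t ∈ Set.Ioo (0 : ℝ) 1) :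
    ∃ q : ℝ, quantile P X t = q ∧ ∀ m : ℝ, q ≤ m ↔ t ≤ P.real {ω | X ω ≤ m} := by
  have := Measure.isProbabilityMeasure_map hX
  have hF := real_setOf_le_eq_cdf (P := P) hX
  set S : Set ℝ := {m | t ≤ P.real {ω | X ω ≤ m}} with hS
  obtain ⟨a, ha⟩ := ((tendsto_cdf_atTop (P.map X)).eventually_const_le ht.2).exists
  obtain ⟨b, hb⟩ := ((tendsto_cdf_atBot (P.map X)).eventually_lt_const ht.1).exists
  have hne : S.Nonempty := ⟨a, by rw [hS, Set.mem_ofPred_eq, hF]; exact ha⟩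
  have hbdd : BddBelow S := by
    refine ⟨b, fun m hm => ?_⟩
    rw [hS, Set.mem_ofPred_eq, hF] at hm
    by_contra! h
    exact absurd (hm.trans (monotone_cdf _ h.le)) (not_le.2 hb)
  have hup : ∀ {m m' : ℝ}, m ∈ S → m ≤ m' → m' ∈ S := fun {m m'} hm h => by
    rw [hS, Set.mem_ofPred_eq, hF] at hm ⊢
    exact hm.trans (monotone_cdf _ h)
  have hmem : sInf S ∈ S := by
    rw [hS, Set.mem_ofPred_eq, hF, ← hS]
    have hcont : Tendsto (cdf (P.map X)) (𝓝[>] (sInf S)) (𝓝 (cdf (P.map X) (sInf S))) :=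
      ((cdf (P.map X)).right_continuous _).tendsto.mono_left
        (nhdsWithin_mono _ Set.Ioi_subset_Ici_self)
    refine ge_of_tendsto hcont (eventually_nhdsWithin_of_forall fun m hm => ?_)
    obtain ⟨s, hs, hsm⟩ := exists_lt_of_csInf_lt hne hm
    simpa only [hS, Set.mem_ofPred_eq, hF] using hup hs hsm.le
  refine ⟨sInf S, ?_, fun m => ⟨fun h => hup hmem h, fun h => csInf_le hbdd h⟩⟩
  refine IsGLB.sInf_eq (IsLeast.isGLB ⟨⟨_, hmem, rfl⟩, ?_⟩)
  rintro _ ⟨m, hm, rfl⟩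
  exact EReal.coe_le_coe_iff.2 (csInf_le hbdd hm)

/-- The Galois connection between the quantile function and the distribution function; every
property of quantiles below is derived from it. -/
lemma realQuantile_le_iff (hX : AEMeasurable X P) {t : ℝ} (ht : t ∈ Set.Ioo (0 : ℝ) 1) {m : ℝ} :
    realQuantile P X t ≤ m ↔ t ≤ P.real {ω | X ω ≤ m} := by
  obtain ⟨q, hq, h⟩ := exists_quantile_eq_coe hX ht
  rw [realQuantile, hq, EReal.toReal_coe, h]

lemma lt_realQuantile_iff (hX : AEMeasurable X P) {t : ℝ} (ht : t ∈ Set.Ioo (0 : ℝ) 1) {m : ℝ} :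
    m < realQuantile P X t ↔ P.real {ω | X ω ≤ m} < t := by
  rw [← not_le, realQuantile_le_iff hX ht, not_le]

lemma monotoneOn_realQuantile (hX : AEMeasurable X P) :
    MonotoneOn (realQuantile P X) (Set.Ioo 0 1) := fun s hs t ht hst => by
  rw [realQuantile_le_iff hX hs]
  exact hst.trans ((realQuantile_le_iff hX ht).1 le_rfl)

lemma aemeasurable_realQuantile (hX : AEMeasurable X P) :
    AEMeasurable (realQuantile P X) (volume.restrict (Set.Ioo 0 1)) :=
  aemeasurable_restrict_of_monotoneOn measurableSet_Ioo (monotoneOn_realQuantile hX)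

/-- Quantiles commute with continuous monotone transformations. -/
lemma realQuantile_comp {f : ℝ → ℝ} (hf : Continuous f) (hmono : Monotone f)
    (hX : AEMeasurable X P) {t : ℝ} (ht : t ∈ Set.Ioo (0 : ℝ) 1) :
    realQuantile P (fun ω => f (X ω)) t = f (realQuantile P X t) := by
  have hfX : AEMeasurable (fun ω => f (X ω)) P := hf.measurable.comp_aemeasurable hX
  refine le_antisymm ?_ (le_of_forall_lt fun m hm => ?_)
  · rw [realQuantile_le_iff hfX ht]
    exact ((realQuantile_le_iff hX ht).1 le_rfl).trans
      (measureReal_mono fun ω hω => hmono hω)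
  · -- by continuity the inequality `m < f` persists slightly to the left of the quantile
    have hev : ∀ᶠ x in 𝓝[<] (realQuantile P X t), m < f x :=
      (hf.continuousAt.eventually_const_lt hm).filter_mono nhdsWithin_le_nhds
    obtain ⟨x, hx, hxq⟩ := (hev.and self_mem_nhdsWithin).exists
    rw [lt_realQuantile_iff hfX ht]
    refine (measureReal_mono fun ω hω => ?_).trans_lt ((lt_realQuantile_iff hX ht).1 hxq)
    by_contra h
    exact absurd (hx.trans_le (hmono (not_le.1 h).le)) (not_lt.2 hω)

lemma abs_realQuantile_le_of_abs_le (hX : AEMeasurable X P) {M : ℝ} (hM : ∀ᵐ ω ∂P, |X ω| ≤ M)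
    {t : ℝ} (ht : t ∈ Set.Ioo (0 : ℝ) 1) : |realQuantile P X t| ≤ M := by
  rw [abs_le]
  constructor
  · refine le_of_forall_lt fun m hm => ?_
    rw [lt_realQuantile_iff hX ht]
    have : P.real {ω | X ω ≤ m} = P.real (∅ : Set Ω) := by
      refine measureReal_congr (eventuallyEq_set.2 ?_)
      filter_upwards [hM] with ω hω
      simpa using hm.trans_le (abs_le.1 hω).1
    rw [this, measureReal_empty]
    exact ht.1
  · rw [realQuantile_le_iff hX ht]
    have : P.real {ω | X ω ≤ M} = P.real (Set.univ : Set Ω) := by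
      refine measureReal_congr (eventuallyEq_set.2 ?_)
      filter_upwards [hM] with ω hω
      simpa using (abs_le.1 hω).2
    rw [this, probReal_univ]
    exact ht.2.le

/-- Markov's inequality for `exp (-X)` and `exp X` bounds the quantiles of `X` by logarithms, which
are integrable over `(0, 1)` and whose averages over `(0, l)` grow like `log (1 / l)`. -/
lemma abs_realQuantile_le_of_mgf_le (hX : AEMeasurable X P) {K : ℝ}
    (hint : ∀ s : ℝ, Integrable (fun ω => Real.exp (s * X ω)) P)
    (h₁ : mgf X P 1 ≤ Real.exp K) (h₂ : mgf X P (-1) ≤ Real.exp K)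
    {t : ℝ} (ht : t ∈ Set.Ioo (0 : ℝ) 1) :
    |realQuantile P X t| ≤ K - Real.log t - Real.log (1 - t) := by
  have ht' : 0 < 1 - t := sub_pos.2 ht.2
  have hlog₁ : Real.log t ≤ 0 := Real.log_nonpos ht.1.le ht.2.le
  have hlog₂ : Real.log (1 - t) ≤ 0 := Real.log_nonpos ht'.le (by linarith [ht.1])
  rw [abs_le]
  constructor
  · set q := realQuantile P X t
    have h : t ≤ P.real {ω | X ω ≤ q} := (realQuantile_le_iff hX ht).1 le_rfl
    have h' := measure_le_le_exp_mul_mgf q (by norm_num : (-1 : ℝ) ≤ 0) (hint (-1))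
    have h3 : t ≤ Real.exp (q + K) := by
      rw [Real.exp_add]
      refine (h.trans h').trans ?_
      rw [neg_neg, one_mul]
      gcongr
    have := (Real.log_le_iff_le_exp ht.1).2 h3
    linarith
  · refine le_of_forall_lt fun x hx => ?_
    have h := (lt_realQuantile_iff hX ht).1 hx
    have h' := measure_ge_le_exp_mul_mgf x (by norm_num : (0 : ℝ) ≤ 1) (hint 1)
    have h4 : 1 - P.real {ω | X ω ≤ x} ≤ P.real {ω | x ≤ X ω} := by
      have h5 : (1 : ℝ) ≤ P.real {ω | X ω ≤ x} + P.real {ω | x ≤ X ω} := by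
        rw [← probReal_univ (μ := P)]
        refine (measureReal_mono fun ω _ => ?_).trans (measureReal_union_le _ _)
        exact le_total (X ω) x
      linarith
    have h3 : 1 - t < Real.exp (-x + K) := by
      rw [Real.exp_add]
      have : Real.exp (-1 * x) * mgf X P 1 ≤ Real.exp (-x) * Real.exp K := by
        rw [neg_one_mul]; gcongr
      linarith
    have := (Real.log_lt_iff_lt_exp ht').2 h3
    linarith

/-- Under convergence in distribution, quantiles converge at each level at which the distribution
function of the limit increases strictly. Only the one-sided portmanteau inequalities are used, so
that atoms of the limit do not matter. -/
lemma tendsto_realQuantile {Ω' : Type*} [MeasurableSpace Ω'] {P' : Measure Ω'}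
    [IsProbabilityMeasure P'] {Y : ℕ → Ω → ℝ} {W : Ω' → ℝ}
    (h : TendstoInDistribution Y atTop W (fun _ => P) P') {t : ℝ} (ht : t ∈ Set.Ioo (0 : ℝ) 1)
    (hstrict : ∀ ε > 0, t < P'.real {ω | W ω ≤ realQuantile P' W t + ε}) :
    Tendsto (fun n => realQuantile P (Y n) t) atTop (𝓝 (realQuantile P' W t)) := by
  have hY := h.forall_aemeasurable
  have hW := h.aemeasurable_limit
  refine tendsto_order.2 ⟨fun a ha => ?_, fun b hb => ?_⟩
  · have h1 := ProbabilityMeasure.limsup_measure_closed_le_of_tendsto h.tendsto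
      (isClosed_Iic (a := a))
    have h2 : P'.map W (Set.Iic a) < ENNReal.ofReal t := by
      rw [Measure.map_apply_of_aemeasurable hW measurableSet_Iic,
        ← ofReal_measureReal, ENNReal.ofReal_lt_ofReal_iff ht.1]
      exact (lt_realQuantile_iff hW ht).1 ha
    filter_upwards [eventually_lt_of_limsup_lt (h1.trans_lt h2)] with n hn
    rw [lt_realQuantile_iff (hY n) ht]
    simp only [ProbabilityMeasure.coe_mk] at hn
    rw [Measure.map_apply_of_aemeasurable (hY n) measurableSet_Iic,
        ← ofReal_measureReal, ENNReal.ofReal_lt_ofReal_iff ht.1] at hn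
    exact hn
  · obtain ⟨c, hc, hcb⟩ := exists_between hb
    have h1 := ProbabilityMeasure.le_liminf_measure_open_of_tendsto h.tendsto
      (isOpen_Iio (a := c))
    have h2 : ENNReal.ofReal t < P'.map W (Set.Iio c) := by
      have hε : 0 < (c - realQuantile P' W t) / 2 := by linarith
      rw [Measure.map_apply_of_aemeasurable hW measurableSet_Iio,
        ← ofReal_measureReal, ENNReal.ofReal_lt_ofReal_iff_of_nonneg ht.1.le]
      refine (hstrict _ hε).trans_le (measureReal_mono fun ω hω => ?_)
      have : W ω ≤ _ := hω
      exact Set.mem_preimage.2 (Set.mem_Iio.2 (by linarith))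
    filter_upwards [eventually_lt_of_lt_liminf (h2.trans_le h1)] with n hn
    simp only [ProbabilityMeasure.coe_mk] at hn
    rw [Measure.map_apply_of_aemeasurable (hY n) measurableSet_Iio,
      ← ofReal_measureReal, ENNReal.ofReal_lt_ofReal_iff_of_nonneg ht.1.le] at hn
    refine lt_of_le_of_lt ((realQuantile_le_iff (hY n) ht).2 (hn.le.trans ?_)) hcb
    exact measureReal_mono fun ω hω => le_of_lt (Set.mem_Iio.1 (Set.mem_preimage.1 hω))

end Quantile

/-! ### Averages over initial intervals -/

lemma integrableOn_log_envelope (K : ℝ) :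
    IntegrableOn (fun t => K - Real.log t - Real.log (1 - t)) (Set.Ioo 0 1) := by
  have h1 : IntervalIntegrable Real.log volume 0 1 := intervalIntegral.intervalIntegrable_log'
  have h2 : IntervalIntegrable (fun t => Real.log (1 - t)) volume 0 1 := by
    simpa using (h1.comp_sub_left 1).symm
  have := ((intervalIntegrable_const (μ := volume) (a := 0) (b := 1) (c := K)).sub h1).sub h2
  rwa [intervalIntegrable_iff_integrableOn_Ioo_of_le zero_le_one] at this

/-- The average over `(0, l)` of the logarithmic envelope of the quantiles is integrable in `l`
precisely because of the assumption on `∫ log (1 / l) μ(dl)`. -/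
lemma average_log_envelope_le (K : ℝ) {l : ℝ} (hl : l ∈ Set.Ioc (0 : ℝ) 1) :
    1 / l * ∫ t in (0 : ℝ)..l, (K - Real.log t - Real.log (1 - t)) ≤
      K + 2 + Real.log (1 / l) := by
  have h1 : IntervalIntegrable Real.log volume 0 l := intervalIntegral.intervalIntegrable_log'
  have h2 : IntervalIntegrable (fun t => Real.log (1 - t)) volume 0 l := by
    have : IntervalIntegrable Real.log volume (1 - l) 1 := intervalIntegral.intervalIntegrable_log'
    simpa using (this.comp_sub_left 1).symm
  have e : ∫ t in (0 : ℝ)..l, Real.log (1 - t) = -(1 - l) * Real.log (1 - l) - l := by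
    rw [intervalIntegral.integral_comp_sub_left (fun x => Real.log x) 1, integral_log]
    simp
    ring
  rw [intervalIntegral.integral_sub (intervalIntegrable_const.sub h1) h2,
    intervalIntegral.integral_sub intervalIntegrable_const h1, e, integral_log,
    intervalIntegral.integral_const, one_div, Real.log_inv, inv_mul_le_iff₀ hl.1]
  have : (1 - l) * Real.log (1 - l) ≤ 0 :=
    mul_nonpos_of_nonneg_of_nonpos (by linarith [hl.2])
      (Real.log_nonpos (by linarith [hl.2]) (by linarith [hl.1]))
  simp only [sub_zero, smul_eq_mul, zero_mul]
  linarith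

section Average

variable {h : ℝ → ℝ} {C K : ℝ}

lemma integrableOn_of_le_log_envelope (hm : AEMeasurable h (volume.restrict (Set.Ioo 0 1)))
    (hb : ∀ t ∈ Set.Ioo (0 : ℝ) 1, |h t| ≤ C * (K - Real.log t - Real.log (1 - t))) :
    IntegrableOn h (Set.Ioo 0 1) :=
  ((integrableOn_log_envelope K).const_mul C).mono' hm.aestronglyMeasurable
    ((ae_restrict_iff' measurableSet_Ioo).2 (ae_of_all _ hb))

lemma intervalIntegrable_of_integrableOn_Ioo (hi : IntegrableOn h (Set.Ioo 0 1)) {l : ℝ}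
    (hl : l ∈ Set.Ioc (0 : ℝ) 1) : IntervalIntegrable h volume 0 l :=
  (intervalIntegrable_iff_integrableOn_Ioo_of_le hl.1.le).2
    (hi.mono_set (Set.Ioo_subset_Ioo_right hl.2))

lemma abs_average_le (hm : AEMeasurable h (volume.restrict (Set.Ioo 0 1)))
    (hb : ∀ t ∈ Set.Ioo (0 : ℝ) 1, |h t| ≤ C * (K - Real.log t - Real.log (1 - t)))
    (hC : 0 ≤ C) {l : ℝ} (hl : l ∈ Set.Ioc (0 : ℝ) 1) :
    |1 / l * ∫ t in (0 : ℝ)..l, h t| ≤ C * (K + 2 + Real.log (1 / l)) := by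
  have hi := intervalIntegrable_of_integrableOn_Ioo (integrableOn_of_le_log_envelope hm hb) hl
  have hg := intervalIntegrable_of_integrableOn_Ioo (integrableOn_log_envelope K) hl
  have hl0 : 0 ≤ 1 / l := one_div_nonneg.2 hl.1.le
  rw [abs_mul, abs_of_nonneg hl0]
  calc 1 / l * |∫ t in (0 : ℝ)..l, h t|
      ≤ 1 / l * ∫ t in (0 : ℝ)..l, C * (K - Real.log t - Real.log (1 - t)) := by
        refine mul_le_mul_of_nonneg_left ?_ hl0
        refine (intervalIntegral.abs_integral_le_integral_abs hl.1.le).trans ?_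
        exact intervalIntegral.integral_mono_on_of_le_Ioo hl.1.le hi.abs (hg.const_mul C)
          fun t ht => hb t ⟨ht.1, ht.2.trans_le hl.2⟩
    _ = C * (1 / l * ∫ t in (0 : ℝ)..l, (K - Real.log t - Real.log (1 - t))) := by
        rw [intervalIntegral.integral_const_mul]; ring
    _ ≤ _ := mul_le_mul_of_nonneg_left (average_log_envelope_le K hl) hC

variable {μ : Measure ℝ}

lemma aestronglyMeasurable_average (hμ : ∀ᵐ l ∂μ, l ∈ Set.Ioc (0 : ℝ) 1)
    (hi : IntegrableOn h (Set.Ioo 0 1)) :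
    AEStronglyMeasurable (fun l => 1 / l * ∫ t in (0 : ℝ)..l, h t) μ := by
  have hcont : ContinuousOn (fun l => ∫ t in (0 : ℝ)..l, h t) (Set.Ioc 0 1) := by
    have h1 : IntegrableOn h (Set.uIcc 0 1) := by
      rwa [Set.uIcc_of_le zero_le_one, integrableOn_Icc_iff_integrableOn_Ioo]
    refine (intervalIntegral.continuousOn_primitive_interval h1).mono ?_
    rw [Set.uIcc_of_le zero_le_one]
    exact Set.Ioc_subset_Icc_self
  have := ((continuousOn_const (c := (1 : ℝ))).div continuousOn_id
    fun (l : ℝ) (hl : l ∈ Set.Ioc (0 : ℝ) 1) => hl.1.ne').mul hcont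
  have := this.aestronglyMeasurable (μ := μ) measurableSet_Ioc
  rwa [Measure.restrict_eq_self_of_ae_mem hμ] at this

lemma integrable_average [IsProbabilityMeasure μ] (hμ : ∀ᵐ l ∂μ, l ∈ Set.Ioc (0 : ℝ) 1)
    (hlog : Integrable (fun l : ℝ => Real.log (1 / l)) μ)
    (hm : AEMeasurable h (volume.restrict (Set.Ioo 0 1)))
    (hb : ∀ t ∈ Set.Ioo (0 : ℝ) 1, |h t| ≤ C * (K - Real.log t - Real.log (1 - t)))
    (hC : 0 ≤ C) : Integrable (fun l => 1 / l * ∫ t in (0 : ℝ)..l, h t) μ := by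
  refine (((integrable_const (K + 2)).add hlog).const_mul C).mono'
    (aestronglyMeasurable_average hμ (integrableOn_of_le_log_envelope hm hb)) ?_
  filter_upwards [hμ] with l hl
  exact abs_average_le hm hb hC hl

/-- Dominated convergence, once in `t` and once in `l`, for mixtures of averages. -/
lemma tendsto_integral_average [IsProbabilityMeasure μ] {f : ℕ → ℝ → ℝ}
    (hμ : ∀ᵐ l ∂μ, l ∈ Set.Ioc (0 : ℝ) 1)
    (hlog : Integrable (fun l : ℝ => Real.log (1 / l)) μ)
    (hm : ∀ n, AEMeasurable (f n) (volume.restrict (Set.Ioo 0 1)))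
    (hb : ∀ n, ∀ t ∈ Set.Ioo (0 : ℝ) 1, |f n t| ≤ C * (K - Real.log t - Real.log (1 - t)))
    (hC : 0 ≤ C)
    (hlim : ∀ t ∈ Set.Ioo (0 : ℝ) 1, Tendsto (fun n => f n t) atTop (𝓝 (h t))) :
    Tendsto (fun n => ∫ l, (1 / l * ∫ t in (0 : ℝ)..l, f n t) ∂μ) atTop
      (𝓝 (∫ l, (1 / l * ∫ t in (0 : ℝ)..l, h t) ∂μ)) := by
  refine tendsto_integral_of_dominated_convergence
    (fun l => C * (K + 2 + Real.log (1 / l)))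
    (fun n => aestronglyMeasurable_average hμ (integrableOn_of_le_log_envelope (hm n) (hb n)))
    (((integrable_const (K + 2)).add hlog).const_mul C) (fun n => ?_) ?_
  · filter_upwards [hμ] with l hl
    exact abs_average_le (hm n) (hb n) hC hl
  · filter_upwards [hμ] with l hl
    refine Tendsto.const_mul _ ?_
    have key (g : ℝ → ℝ) : ∫ t in (0 : ℝ)..l, g t = ∫ t in Set.Ioo 0 l, g t := by
      rw [intervalIntegral.integral_of_le hl.1.le, integral_Ioc_eq_integral_Ioo]
    have hsub : Set.Ioo (0 : ℝ) l ⊆ Set.Ioo 0 1 := Set.Ioo_subset_Ioo_right hl.2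
    simp only [key]
    refine tendsto_integral_of_dominated_convergence
      (fun t => C * (K - Real.log t - Real.log (1 - t)))
      (fun n => ((hm n).mono_measure (Measure.restrict_mono hsub le_rfl)).aestronglyMeasurable)
      (((integrableOn_log_envelope K).mono_set hsub).const_mul C) (fun n => ?_) ?_
    · exact (ae_restrict_iff' measurableSet_Ioo).2 (ae_of_all _ fun t ht => hb n t (hsub ht))
    · exact (ae_restrict_iff' measurableSet_Ioo).2 (ae_of_all _ fun t ht => hlim t (hsub ht))

end Average

/-! ### The standard normal distribution -/

section Normal

/-- The quantile function of `X`, under Lebesgue measure on `(0, 1)`, has the law of `X`. -/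
lemma map_realQuantile {Ω : Type*} [MeasurableSpace Ω] {P : Measure Ω} [IsProbabilityMeasure P]
    {X : Ω → ℝ} (hX : AEMeasurable X P) :
    (volume.restrict (Set.Ioo (0 : ℝ) 1)).map (realQuantile P X) = P.map X := by
  have hm := aemeasurable_realQuantile hX
  have : IsProbabilityMeasure (volume.restrict (Set.Ioo (0 : ℝ) 1)) := ⟨by simp⟩
  have := Measure.isProbabilityMeasure_map hX
  have := Measure.isProbabilityMeasure_map hm
  refine Measure.ext_of_Iic _ _ fun m => ?_
  rw [Measure.map_apply_of_aemeasurable hm measurableSet_Iic,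
    Measure.map_apply_of_aemeasurable hX measurableSet_Iic,
    Measure.restrict_apply' measurableSet_Ioo]
  set p := P.real {ω | X ω ≤ m}
  have hp : p ≤ 1 := measureReal_le_one
  have : (realQuantile P X ⁻¹' Set.Iic m ∩ Set.Ioo 0 1 : Set ℝ) =ᵐ[volume]
      (Set.Ioo 0 p : Set ℝ) := by
    -- the two sets can differ only at the level `p`
    have h0 : ∀ᵐ t : ℝ, t ≠ p := by simp [ae_iff]
    refine eventuallyEq_set.2 ?_
    have h1 : ∀ᵐ t : ℝ, t ≠ 1 := by simp [ae_iff]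
    filter_upwards [h0, h1] with t ht ht1
    constructor
    · rintro ⟨h, h'⟩
      exact ⟨h'.1, lt_of_le_of_ne ((realQuantile_le_iff hX h').1 h) ht⟩
    · intro h
      have h' : t ∈ Set.Ioo (0 : ℝ) 1 := ⟨h.1, h.2.trans_le hp⟩
      exact ⟨(realQuantile_le_iff hX h').2 h.2.le, h'⟩
  rw [measure_congr this, Real.volume_Ioo, sub_zero, ofReal_measureReal]
  rfl

lemma strictMono_gaussian_real_Iic :
    StrictMono fun x : ℝ => (gaussianReal 0 1).real (Set.Iic x) := by
  intro a b hab
  have hpos : 0 < (gaussianReal 0 1).real (Set.Ioc a b) := by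
    rw [measureReal_def, ENNReal.toReal_pos_iff]
    refine ⟨pos_iff_ne_zero.2 fun h => ?_, measure_lt_top _ _⟩
    have := gaussianReal_absolutelyContinuous' 0 one_ne_zero h
    rw [Real.volume_Ioc, ENNReal.ofReal_eq_zero] at this
    linarith
  have := measureReal_union (μ := gaussianReal 0 1) (s₁ := Set.Iic a) (s₂ := Set.Ioc a b)
    (Set.Iic_disjoint_Ioc le_rfl) measurableSet_Ioc
  rw [Set.Iic_union_Ioc_eq_Iic hab.le] at this
  simp only [this]
  linarith

lemma gaussianReal_real_Iic_lt_one (x : ℝ) : (gaussianReal 0 1).real (Set.Iic x) < 1 :=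
  (strictMono_gaussian_real_Iic (lt_add_one x)).trans_le measureReal_le_one

variable {Ω : Type*} [MeasurableSpace Ω] {P : Measure Ω} [IsProbabilityMeasure P]
  {Z : Ω → ℝ} (hZ : HasLaw Z (gaussianReal 0 1) P)
include hZ

omit [IsProbabilityMeasure P] in
lemma real_setOf_le_normal (x : ℝ) :
    P.real {ω | Z ω ≤ x} = (gaussianReal 0 1).real (Set.Iic x) := by
  rw [← hZ.map_eq, map_measureReal_apply_of_aemeasurable hZ.aemeasurable measurableSet_Iic]
  rfl

lemma real_setOf_le_realQuantile_normal {t : ℝ} (ht : t ∈ Set.Ioo (0 : ℝ) 1) :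
    P.real {ω | Z ω ≤ realQuantile P Z t} = t := by
  refine le_antisymm ?_ ((realQuantile_le_iff hZ.aemeasurable ht).1 le_rfl)
  set q := realQuantile P Z t
  have h1 : Function.leftLim (cdf (gaussianReal 0 1)) q ≤ t := by
    refine le_of_tendsto ((monotone_cdf _).tendsto_leftLim q)
      (eventually_nhdsWithin_of_forall fun m hm => ?_)
    rw [cdf_eq_real, ← real_setOf_le_normal hZ]
    exact ((lt_realQuantile_iff hZ.aemeasurable ht).1 hm).le
  have h2 := (cdf (gaussianReal 0 1)).measure_singleton q
  have := nullSingletonClass_gaussianReal (μ := 0) (v := 1) one_ne_zero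
  rw [measure_cdf, measure_singleton, eq_comm, ENNReal.ofReal_eq_zero] at h2
  rw [real_setOf_le_normal hZ, ← cdf_eq_real]
  linarith

omit hZ in
lemma setIntegral_Iic_id_gaussianReal (z : ℝ) :
    ∫ x in Set.Iic z, x ∂(gaussianReal 0 1) = -gaussianPDFReal 0 1 z := by
  have hpdf : ∀ x, gaussianPDFReal 0 1 x = (√(2 * Real.pi))⁻¹ * Real.exp (-(1 / 2) * x ^ 2) := by
    intro x
    simp only [gaussianPDFReal, NNReal.coe_one, mul_one, sub_zero]
    congr 2
    ring
  rw [← integral_indicator measurableSet_Iic,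
    integral_gaussianReal_eq_integral_smul one_ne_zero]
  have h1 : ∀ x, gaussianPDFReal 0 1 x • (Set.Iic z).indicator (fun x => x) x =
      (Set.Iic z).indicator (fun x => x * gaussianPDFReal 0 1 x) x := by
    intro x
    by_cases hx : x ∈ Set.Iic z <;> simp [hx, mul_comm]
  simp only [h1]
  rw [integral_indicator measurableSet_Iic]
  have hint : Integrable (fun x => x * gaussianPDFReal 0 1 x) := by
    have := (integrable_mul_exp_neg_mul_sq (b := 1 / 2) (by norm_num)).const_mul
      (√(2 * Real.pi))⁻¹
    refine this.congr (ae_of_all _ fun x => ?_)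
    simp only [hpdf]; ring
  have hderiv : ∀ x ∈ Set.Iic z, HasDerivAt (fun x => -gaussianPDFReal 0 1 x)
      (x * gaussianPDFReal 0 1 x) x := by
    intro x _
    simp only [hpdf]
    have h2 : HasDerivAt (fun x : ℝ => -(1 / 2) * x ^ 2) (-x) x :=
      ((hasDerivAt_pow 2 x).const_mul (-(1 / 2 : ℝ))).congr_deriv (by push_cast; ring)
    exact (h2.exp.const_mul (√(2 * Real.pi))⁻¹).neg.congr_deriv (by ring)
  have hlim : Tendsto (fun x => -gaussianPDFReal 0 1 x) atBot (𝓝 0) := by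
    have h3 : Tendsto (fun x : ℝ => -(1 / 2) * x ^ 2) atBot atBot := by
      refine Tendsto.const_mul_atTop_of_neg (by norm_num) ?_
      simp only [pow_two]
      exact tendsto_id.atBot_mul_atBot₀ tendsto_id
    have h4 := ((Real.tendsto_exp_atBot.comp h3).const_mul (√(2 * Real.pi))⁻¹).neg
    simp only [mul_zero, neg_zero] at h4
    refine h4.congr fun x => ?_
    simp [hpdf]
  rw [integral_Iic_of_hasDerivAt_of_tendsto' hderiv hint.integrableOn hlim, sub_zero]

lemma integral_realQuantile_normal {l : ℝ} (hl : l ∈ Set.Ioo (0 : ℝ) 1) :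
    ∫ t in (0 : ℝ)..l, realQuantile P Z t = -gaussianPDFReal 0 1 (realQuantile P Z l) := by
  have hm := aemeasurable_realQuantile hZ.aemeasurable
  rw [intervalIntegral.integral_of_le hl.1.le, ← setIntegral_Iic_id_gaussianReal,
    ← integral_indicator measurableSet_Iic, ← hZ.map_eq, ← map_realQuantile hZ.aemeasurable,
    integral_map hm ((by fun_prop : AEStronglyMeasurable (fun x : ℝ => x) _).indicator
      measurableSet_Iic),
    ← integral_indicator measurableSet_Ioc,
    ← integral_indicator measurableSet_Ioo]
  congr 1 with t
  by_cases ht : t ∈ Set.Ioo (0 : ℝ) 1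
  · have h : realQuantile P Z t ≤ realQuantile P Z l ↔ t ≤ l := by
      rw [realQuantile_le_iff hZ.aemeasurable ht, real_setOf_le_realQuantile_normal hZ hl]
    rw [Set.indicator_of_mem ht]
    by_cases htl : t ≤ l
    · rw [Set.indicator_of_mem (Set.mem_Ioc.2 ⟨ht.1, htl⟩),
        Set.indicator_of_mem (Set.mem_Iic.2 (h.2 htl))]
    · rw [Set.indicator_of_notMem (fun h' => htl h'.2),
        Set.indicator_of_notMem (fun h' => htl (h.1 (Set.mem_Iic.1 h')))]
  · rw [Set.indicator_of_notMem ht, Set.indicator_of_notMem]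
    exact fun h' => ht ⟨h'.1, h'.2.trans_lt hl.2⟩

lemma integral_realQuantile_normal_one : ∫ t in (0 : ℝ)..1, realQuantile P Z t = 0 := by
  have hm := aemeasurable_realQuantile hZ.aemeasurable
  have h := integral_map hm (f := fun x : ℝ => x) (by fun_prop)
  rw [map_realQuantile hZ.aemeasurable, hZ.map_eq, integral_id_gaussianReal] at h
  rw [intervalIntegral.integral_of_le zero_le_one, integral_Ioc_eq_integral_Ioo, ← h]

omit hZ in
lemma stdNormalCDF_coe (x : ℝ) : stdNormalCDF x = (gaussianReal 0 1).real (Set.Iic x) := by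
  simp [stdNormalCDF, Set.Iic]

omit hZ in
lemma stdNormalCDF_top : stdNormalCDF ⊤ = 1 := by simp [stdNormalCDF]

omit hZ in
lemma stdNormalCDF_bot : stdNormalCDF ⊥ = 0 := by simp [stdNormalCDF]

omit hZ in
lemma strictMono_stdNormalCDF : StrictMono stdNormalCDF := by
  have hpos (x : ℝ) : 0 < (gaussianReal 0 1).real (Set.Iic x) :=
    measureReal_nonneg.trans_lt (strictMono_gaussian_real_Iic (sub_one_lt x))
  intro a b hab
  induction a <;> induction b
  all_goals
    simp_all [stdNormalCDF_coe, stdNormalCDF_top, stdNormalCDF_bot, gaussianReal_real_Iic_lt_one]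
  exact strictMono_gaussian_real_Iic hab

lemma stdNormalInv_eq_realQuantile {l : ℝ} (hl : l ∈ Set.Ioo (0 : ℝ) 1) :
    stdNormalInv l = realQuantile P Z l := by
  have : stdNormalCDF (realQuantile P Z l) = l := by
    rw [stdNormalCDF_coe, ← real_setOf_le_normal hZ, real_setOf_le_realQuantile_normal hZ hl]
  conv_lhs => rw [← this]
  exact Function.leftInverse_invFun strictMono_stdNormalCDF.injective _

omit hZ in
lemma stdNormalInv_one : stdNormalInv 1 = ⊤ := by
  rw [← stdNormalCDF_top]
  exact Function.leftInverse_invFun strictMono_stdNormalCDF.injective _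

/-- The average quantile of a standard normal variable in closed form: transported to the normal
law, the integral of the quantile function over `(0, l)` is that of `x` over `(-∞, Φ⁻¹(l)]`, and
`-φ` is a primitive of `x φ(x)`. -/
lemma avarUtility_normal {l : ℝ} (hl : l ∈ Set.Ioc (0 : ℝ) 1) :
    avarUtility P l Z = -(1 / l * stdNormalPDF (stdNormalInv l)) := by
  change 1 / l * ∫ t in (0 : ℝ)..l, realQuantile P Z t = _
  rcases hl.2.eq_or_lt with rfl | h1
  · rw [integral_realQuantile_normal_one hZ, stdNormalInv_one]
    simp [stdNormalPDF]
  · rw [integral_realQuantile_normal hZ ⟨hl.1, h1⟩, stdNormalInv_eq_realQuantile hZ ⟨hl.1, h1⟩]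
    simp [stdNormalPDF]

lemma abs_realQuantile_normal_le {t : ℝ} (ht : t ∈ Set.Ioo (0 : ℝ) 1) :
    |realQuantile P Z t| ≤ 1 / 2 - Real.log t - Real.log (1 - t) := by
  refine abs_realQuantile_le_of_mgf_le hZ.aemeasurable (fun s => ?_) ?_ ?_ ht
  · rw [← mgf_pos_iff, mgf_gaussianReal hZ.map_eq]
    positivity
  all_goals
    rw [mgf_gaussianReal hZ.map_eq]
    norm_num

end Normal

/-! ### Normalized sums of bounded i.i.d. variables -/

section NormalizedSum

variable {Ω : Type*} [MeasurableSpace Ω] {P : Measure Ω} [IsProbabilityMeasure P] {X : ℕ → Ω → ℝ}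

/-- The centred sum `(X 0 + ⋯ + X (n - 1) - n E[X 0]) / √n` of the central limit theorem. -/
noncomputable def normalizedSum {Ω : Type*} [MeasurableSpace Ω] (P : Measure Ω) (X : ℕ → Ω → ℝ)
    (n : ℕ) (ω : Ω) : ℝ :=
  (√n)⁻¹ * (∑ k ∈ Finset.range n, X k ω - n * P[X 0])

omit [IsProbabilityMeasure P] in
lemma mean_eq_add_normalizedSum {n : ℕ} (hn : n ≠ 0) (ω : Ω) :
    (∑ i ∈ Finset.range n, X i ω) / n = P[X 0] + (√n)⁻¹ * normalizedSum P X n ω := by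
  have h : (0 : ℝ) < n := by positivity
  rw [normalizedSum, ← mul_assoc, ← mul_inv, Real.mul_self_sqrt h.le]
  field_simp
  ring

omit [IsProbabilityMeasure P] in
lemma exists_ae_abs_le {f : Ω → ℝ} (hf : MemLp f ⊤ P) : ∃ M : ℝ, ∀ᵐ ω ∂P, |f ω| ≤ M := by
  refine ⟨(eLpNorm f ⊤ P).toReal, ?_⟩
  filter_upwards [ae_le_eLpNormEssSup (f := f) (μ := P)] with ω hω
  have h : ‖f ω‖ₑ ≤ eLpNorm f ⊤ P := by rwa [eLpNorm_exponent_top]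
  rw [← Real.norm_eq_abs, ← toReal_enorm]
  exact ENNReal.toReal_mono hf.2.ne h

variable (hX_ident : ∀ i, IdentDistrib (X i) (X 0) P P)
include hX_ident

omit [IsProbabilityMeasure P] in
lemma aemeasurable_normalizedSum (n : ℕ) : AEMeasurable (normalizedSum P X n) P := by
  have (i : ℕ) := (hX_ident i).aemeasurable_fst
  unfold normalizedSum
  fun_prop

omit [IsProbabilityMeasure P] in
lemma ae_abs_mean_le {M : ℝ} (hM : ∀ᵐ ω ∂P, |X 0 ω| ≤ M) {n : ℕ} (hn : n ≠ 0) :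
    ∀ᵐ ω ∂P, |(∑ i ∈ Finset.range n, X i ω) / n| ≤ M := by
  have h (i : ℕ) : ∀ᵐ ω ∂P, |X i ω| ≤ M :=
    (hX_ident i).symm.ae_snd (p := fun x => |x| ≤ M)
      (measurableSet_le (by fun_prop) (by fun_prop)) hM
  filter_upwards [ae_all_iff.2 h] with ω hω
  have h0 : (0 : ℝ) < n := by positivity
  rw [abs_div, abs_of_pos h0, div_le_iff₀ h0]
  calc |∑ i ∈ Finset.range n, X i ω| ≤ ∑ i ∈ Finset.range n, |X i ω| :=
        Finset.abs_sum_le_sum_abs _ _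
    _ ≤ ∑ i ∈ Finset.range n, M := Finset.sum_le_sum fun i _ => hω i
    _ = M * n := by simp [mul_comm]

/-- By Hoeffding's lemma the normalized sums are sub-Gaussian with a common parameter, so their
quantiles share one logarithmic envelope. -/
lemma exists_abs_realQuantile_normalizedSum_le {M : ℝ} (hM : ∀ᵐ ω ∂P, |X 0 ω| ≤ M)
    (hX_indep : iIndepFun X P) :
    ∃ K : ℝ, ∀ n : ℕ, ∀ t ∈ Set.Ioo (0 : ℝ) 1,
      |realQuantile P (normalizedSum P X n) t| ≤ K - Real.log t - Real.log (1 - t) := by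
  set m : ℝ := ∫ ω, X 0 ω ∂P with hm
  have h0 := hasSubgaussianMGF_of_mem_Icc (hX_ident 0).aemeasurable_fst
    (hM.mono fun ω h => abs_le.1 h)
  set c : NNReal := (‖M - -M‖₊ / 2) ^ 2
  have hsub (i : ℕ) : HasSubgaussianMGF (fun ω => X i ω - m) c P :=
    h0.congr_identDistrib ((hX_ident i).symm.comp (u := fun x => x - m) (by fun_prop))
  have hind : iIndepFun (fun i ω => X i ω - m) P :=
    hX_indep.comp (fun _ x => x - m) (by fun_prop)
  refine ⟨c / 2, fun n t ht => ?_⟩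
  have hY := (HasSubgaussianMGF.sum_of_iIndepFun hind (s := Finset.range n)
    fun i _ => hsub i).const_mul (√n)⁻¹
  have hYeq : (fun ω => (√n)⁻¹ * ∑ i ∈ Finset.range n, (X i ω - m)) =
      normalizedSum P X n := by
    ext ω
    simp [normalizedSum, Finset.sum_sub_distrib, hm]
  rw [hYeq] at hY
  have hmgf (s : ℝ) (hs : s ^ 2 = 1) : mgf (normalizedSum P X n) P s ≤ Real.exp (c / 2) := by
    refine (hY.mgf_le s).trans (Real.exp_le_exp.2 ?_)
    have hn : (n : ℝ)⁻¹ * n ≤ 1 := inv_mul_le_one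
    have hc : (0 : ℝ) ≤ c := c.2
    change (√(n : ℝ))⁻¹ ^ 2 * ((∑ i ∈ Finset.range n, c : NNReal) : ℝ) * s ^ 2 / 2 ≤ c / 2
    rw [hs, inv_pow, Real.sq_sqrt (Nat.cast_nonneg n)]
    simp only [Finset.sum_const, Finset.card_range, nsmul_eq_mul, NNReal.coe_mul,
      NNReal.coe_natCast]
    nlinarith
  exact abs_realQuantile_le_of_mgf_le (aemeasurable_normalizedSum hX_ident n)
    hY.integrable_exp_mul (hmgf 1 (by norm_num)) (hmgf (-1) (by norm_num)) ht

lemma tendsto_realQuantile_normalizedSum (hX : MemLp (X 0) 2 P) (hX_indep : iIndepFun X P)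
    {Ω' : Type*} [MeasurableSpace Ω'] {P' : Measure Ω'} [IsProbabilityMeasure P'] {Z : Ω' → ℝ}
    (hZ : HasLaw Z (gaussianReal 0 1) P') {t : ℝ} (ht : t ∈ Set.Ioo (0 : ℝ) 1) :
    Tendsto (fun n => realQuantile P (normalizedSum P X n) t) atTop
      (𝓝 (√(variance (X 0) P) * realQuantile P' Z t)) := by
  set σ := √(variance (X 0) P)
  have hσ : 0 ≤ σ := Real.sqrt_nonneg _
  have hW : HasLaw (fun ω => σ * Z ω) (gaussianReal 0 (variance (X 0) P).toNNReal) P' := by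
    convert gaussianReal_const_mul hZ σ using 2
    · simp
    · ext
      simp [σ, variance_nonneg, Real.sq_sqrt]
  have hq : realQuantile P' (fun ω => σ * Z ω) t = σ * realQuantile P' Z t :=
    realQuantile_comp (f := fun x => σ * x) (by fun_prop) (monotone_mul_left_of_nonneg hσ)
      hZ.aemeasurable ht
  rw [← hq]
  refine tendsto_realQuantile
    (tendstoInDistribution_inv_sqrt_mul_sum_sub hW hX hX_indep hX_ident) ht fun ε hε => ?_
  rw [hq]
  -- `σ` may vanish, so the shift of the level is divided by `σ + 1`
  have hδ : 0 < ε / (σ + 1) := by positivity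
  calc t = P'.real {ω | Z ω ≤ realQuantile P' Z t} :=
        (real_setOf_le_realQuantile_normal hZ ht).symm
    _ < P'.real {ω | Z ω ≤ realQuantile P' Z t + ε / (σ + 1)} := by
        rw [real_setOf_le_normal hZ, real_setOf_le_normal hZ]
        exact strictMono_gaussian_real_Iic (by linarith)
    _ ≤ _ := by
        refine measureReal_mono fun ω hω => ?_
        have h1 : σ * Z ω ≤ σ * (realQuantile P' Z t + ε / (σ + 1)) :=
          mul_le_mul_of_nonneg_left hω hσ
        have h2 : σ * (ε / (σ + 1)) ≤ ε := by
          rw [← mul_div_assoc, div_le_iff₀ (by positivity)]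
          nlinarith
        have h3 : σ * Z ω ≤ σ * realQuantile P' Z t + ε := by linarith
        exact h3

end NormalizedSum

/-! ### The utility function -/

/-- The delta method, at rate `√n`. -/
lemma tendsto_sqrt_mul_sub {f : ℝ → ℝ} {f' x v : ℝ} (hf : HasDerivAt f f' x) {d : ℕ → ℝ}
    (hd : Tendsto (fun n : ℕ => √n * d n) atTop (𝓝 v)) :
    Tendsto (fun n : ℕ => √n * (f (x + d n) - f x)) atTop (𝓝 (f' * v)) := by
  have hsqrt : Tendsto (fun n : ℕ => √(n : ℝ)) atTop atTop :=
    Real.tendsto_sqrt_atTop.comp tendsto_natCast_atTop_atTop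
  have hd0 : Tendsto d atTop (𝓝 0) := by
    have := hsqrt.inv_tendsto_atTop.mul hd
    rw [zero_mul] at this
    refine this.congr' ?_
    filter_upwards [eventually_ne_atTop 0] with n hn
    have : √(n : ℝ) ≠ 0 := by positivity
    simp [this]
  have := hf.hasFDerivAt.hasFDerivWithinAt (s := Set.univ) |>.lim (l := atTop) hd0
    (Eventually.of_forall fun _ => Set.mem_univ _) (c := fun n : ℕ => √(n : ℝ)) (by simpa using hd)
  simpa [mul_comm] using this

lemma exists_abs_sub_le_of_contDiff {u : ℝ → ℝ} (hu : ContDiff ℝ 1 u) (M : ℝ) :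
    ∃ L, 0 ≤ L ∧ ∀ x ∈ Set.Icc (-M) M, ∀ y ∈ Set.Icc (-M) M, |u y - u x| ≤ L * |y - x| := by
  obtain ⟨L, hL⟩ := (isCompact_Icc (a := -M) (b := M)).exists_bound_of_continuousOn
    (hu.continuous_deriv le_rfl).continuousOn
  refine ⟨max L 0, le_max_right _ _, fun x hx y hy => ?_⟩
  exact (convex_Icc (-M) M).norm_image_sub_le_of_norm_deriv_le
    (fun z _ => (hu.differentiable one_ne_zero).differentiableAt)
    (fun z hz => (hL z hz).trans (le_max_left _ _)) hx hy

/-- Continuous differentiability of `u⁻¹` enters only through this: `u'` does not vanish. -/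
lemma deriv_ne_zero_and_hasDerivAt_invFun {u : ℝ → ℝ} (hu : ContDiff ℝ 1 u)
    (hu_mono : StrictMono u) (hu_inv : ContDiffOn ℝ 1 (Function.invFun u) (Set.range u)) (m : ℝ) :
    deriv u m ≠ 0 ∧ HasDerivAt (Function.invFun u) (deriv u m)⁻¹ (u m) := by
  have hnhds : Set.range u ∈ 𝓝 (u m) := by
    refine mem_of_superset (Icc_mem_nhds (hu_mono (sub_one_lt m)) (hu_mono (lt_add_one m))) ?_
    exact (intermediate_value_Icc (by linarith) hu.continuous.continuousOn).trans
      (Set.image_subset_range _ _)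
  have hinv : HasDerivAt (Function.invFun u) (deriv (Function.invFun u) (u m)) (u m) :=
    ((hu_inv.differentiableOn one_ne_zero).differentiableAt hnhds).hasDerivAt
  have hu' : HasDerivAt u (deriv u m) m :=
    (hu.differentiable one_ne_zero).differentiableAt.hasDerivAt
  have hcomp := hinv.comp m hu'
  have hid : Function.invFun u ∘ u = id := Function.invFun_comp hu_mono.injective
  rw [hid] at hcomp
  have h1 := hcomp.unique (hasDerivAt_id m)
  refine ⟨right_ne_zero_of_mul_eq_one h1, ?_⟩
  rwa [← eq_inv_of_mul_eq_one_left h1]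

/-! ### The limit of the risk premium -/

/-- For `r > 0`, the rescaled deviation of `U_μ(u(m + Y / r))` from `u(m)` is the mixture of averages
of the difference quotients of `u` along the quantiles of `Y`. -/
lemma mul_mixedUtility_comp_sub {Ω : Type*} [MeasurableSpace Ω] {P : Measure Ω}
    [IsProbabilityMeasure P] {μ : Measure ℝ} [IsProbabilityMeasure μ]
    (hμ : ∀ᵐ l ∂μ, l ∈ Set.Ioc (0 : ℝ) 1) {u : ℝ → ℝ} (hu : Continuous u) (hu_mono : StrictMono u)
    {Y : Ω → ℝ} (hY : AEMeasurable Y P) (m : ℝ) {r : ℝ} (hr : 0 < r)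
    (hi : IntegrableOn (fun t => r * (u (m + r⁻¹ * realQuantile P Y t) - u m)) (Set.Ioo 0 1))
    (hi' : Integrable (fun l => 1 / l * ∫ t in (0 : ℝ)..l,
      r * (u (m + r⁻¹ * realQuantile P Y t) - u m)) μ) :
    r * (mixedUtility P μ (fun ω => u (m + r⁻¹ * Y ω)) - u m) =
      ∫ l, (1 / l * ∫ t in (0 : ℝ)..l, r * (u (m + r⁻¹ * realQuantile P Y t) - u m)) ∂μ := by
  have hav : ∀ᵐ l ∂μ, avarUtility P l (fun ω => u (m + r⁻¹ * Y ω)) = u m + r⁻¹ *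
      (1 / l * ∫ t in (0 : ℝ)..l, r * (u (m + r⁻¹ * realQuantile P Y t) - u m)) := by
    filter_upwards [hμ] with l hl
    have h1 : ∫ t in (0 : ℝ)..l, realQuantile P (fun ω => u (m + r⁻¹ * Y ω)) t =
        ∫ t in (0 : ℝ)..l, (u m + r⁻¹ * (r * (u (m + r⁻¹ * realQuantile P Y t) - u m))) := by
      rw [intervalIntegral.integral_of_le hl.1.le, intervalIntegral.integral_of_le hl.1.le,
        integral_Ioc_eq_integral_Ioo, integral_Ioc_eq_integral_Ioo]
      refine setIntegral_congr_fun measurableSet_Ioo fun t ht => ?_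
      have hmono : Monotone fun y => u (m + r⁻¹ * y) := fun a b hab =>
        hu_mono.monotone (by have := inv_pos.2 hr; gcongr)
      simp only [realQuantile_comp (f := fun y => u (m + r⁻¹ * y)) (by fun_prop) hmono hY
        ⟨ht.1, ht.2.trans_le hl.2⟩]
      field_simp
      ring
    have hl0 : l ≠ 0 := hl.1.ne'
    change 1 / l * ∫ t in (0 : ℝ)..l, realQuantile P (fun ω => u (m + r⁻¹ * Y ω)) t = _
    rw [h1, intervalIntegral.integral_add intervalIntegrable_const
      ((intervalIntegrable_of_integrableOn_Ioo hi hl).const_mul _),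
      intervalIntegral.integral_const, intervalIntegral.integral_const_mul]
    simp only [sub_zero, smul_eq_mul]
    rw [mul_add, ← mul_assoc, one_div_mul_cancel hl0, one_mul]
    ring
  rw [mixedUtility, integral_congr_ae hav, integral_add (integrable_const _) (hi'.const_mul _),
    integral_const, integral_const_mul]
  simp only [probReal_univ, one_smul, add_sub_cancel_left]
  rw [mul_inv_cancel_left₀ hr.ne']

section Premium

variable {Ω Ω' : Type*} [MeasurableSpace Ω] [MeasurableSpace Ω']
  {P : Measure Ω} [IsProbabilityMeasure P]
  {μ : Measure ℝ} [IsProbabilityMeasure μ] (hμ : ∀ᵐ l ∂μ, l ∈ Set.Ioc (0 : ℝ) 1)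
  (hlog : Integrable (fun l : ℝ => Real.log (1 / l)) μ)
include hμ hlog

lemma integrable_avarUtility_normal {P' : Measure Ω'} [IsProbabilityMeasure P'] {Z : Ω' → ℝ}
    (hZ : HasLaw Z (gaussianReal 0 1) P') :
    Integrable (fun l : ℝ => avarUtility P' l Z) μ :=
  integrable_average hμ hlog (aemeasurable_realQuantile hZ.aemeasurable)
    (fun _ ht => (abs_realQuantile_normal_le hZ ht).trans_eq (one_mul _).symm) zero_le_one

/-- The first-order expansion `U_μ(u(S_n / n)) = u(E[X_1]) + u'(E[X_1]) σ U_μ(Z) / √n + o(1 / √n)`: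
the difference quotients of `u` along the quantiles of the normalized sums converge pointwise, and
the Lipschitz bound of `u` together with the common envelope of the quantiles dominates them. -/
lemma tendsto_mixedUtility_mean {u : ℝ → ℝ} (hu : ContDiff ℝ 1 u) (hu_mono : StrictMono u)
    {X : ℕ → Ω → ℝ} (hX_bdd : MemLp (X 0) ⊤ P) (hX_indep : iIndepFun X P)
    (hX_ident : ∀ i, IdentDistrib (X i) (X 0) P P)
    {P' : Measure Ω'} [IsProbabilityMeasure P'] {Z : Ω' → ℝ}
    (hZ : HasLaw Z (gaussianReal 0 1) P') :
    Tendsto (fun n : ℕ => √n * (mixedUtility P μ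
        (fun ω => u ((∑ i ∈ Finset.range n, X i ω) / n)) - u (∫ ω, X 0 ω ∂P)))
      atTop (𝓝 (deriv u (∫ ω, X 0 ω ∂P) * (√(variance (X 0) P) * mixedUtility P' μ Z))) := by
  set m : ℝ := ∫ ω, X 0 ω ∂P with hm
  set σ := √(variance (X 0) P)
  obtain ⟨M, hM⟩ := exists_ae_abs_le hX_bdd
  obtain ⟨L, hL0, hL⟩ := exists_abs_sub_le_of_contDiff hu M
  obtain ⟨K, hK⟩ := exists_abs_realQuantile_normalizedSum_le hX_ident hM hX_indep
  have hYm := aemeasurable_normalizedSum hX_ident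
  set q : ℕ → ℝ → ℝ := fun n => realQuantile P (normalizedSum P X n) with hq
  set f : ℕ → ℝ → ℝ := fun n t => √n * (u (m + (√n)⁻¹ * q n t) - u m) with hf
  have hfm (n : ℕ) : AEMeasurable (f n) (volume.restrict (Set.Ioo 0 1)) := by
    have hucont := hu.continuous
    have h1 : Continuous fun y => √(n : ℝ) * (u (m + (√n)⁻¹ * y) - u m) := by fun_prop
    exact h1.measurable.comp_aemeasurable (aemeasurable_realQuantile (hYm n))
  have hmM : m ∈ Set.Icc (-M) M := by
    refine abs_le.1 ?_
    have := norm_integral_le_of_norm_le_const (μ := P) (f := X 0) hM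
    simpa using this
  have hfb (n : ℕ) (t : ℝ) (ht : t ∈ Set.Ioo (0 : ℝ) 1) :
      |f n t| ≤ L * (K - Real.log t - Real.log (1 - t)) := by
    have hKt : |q n t| ≤ K - Real.log t - Real.log (1 - t) := hK n t ht
    rcases eq_or_ne n 0 with rfl | hn
    · simpa [hf] using mul_nonneg hL0 ((abs_nonneg _).trans hKt)
    have hr : 0 < √(n : ℝ) := by positivity
    -- `m + q n t / √n` is a quantile of the mean of the first `n` variables
    have hy : m + (√n)⁻¹ * q n t ∈ Set.Icc (-M) M := by
      have h1 := realQuantile_comp (f := fun y => m + (√n)⁻¹ * y) (by fun_prop)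
        (fun a b hab => by dsimp only; gcongr) (hYm n) ht
      refine abs_le.1 ?_
      rw [hq, ← h1]
      refine abs_realQuantile_le_of_abs_le ((hYm n).const_mul _ |>.const_add _) ?_ ht
      filter_upwards [ae_abs_mean_le hX_ident hM hn] with ω hω
      rwa [mean_eq_add_normalizedSum (P := P) hn] at hω
    calc |f n t| = √n * |u (m + (√n)⁻¹ * q n t) - u m| := by
          rw [hf, abs_mul, abs_of_pos hr]
      _ ≤ √n * (L * |m + (√n)⁻¹ * q n t - m|) := by
          gcongr
          exact hL m hmM _ hy
      _ = L * |q n t| := by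
          rw [add_sub_cancel_left, abs_mul, abs_of_pos (inv_pos.2 hr)]
          field_simp
      _ ≤ _ := by gcongr
  have hflim (t : ℝ) (ht : t ∈ Set.Ioo (0 : ℝ) 1) :
      Tendsto (fun n => f n t) atTop (𝓝 (deriv u m * (σ * realQuantile P' Z t))) := by
    refine tendsto_sqrt_mul_sub ((hu.differentiable one_ne_zero).differentiableAt.hasDerivAt) ?_
    refine (tendsto_realQuantile_normalizedSum hX_ident (hX_bdd.mono_exponent le_top) hX_indep
      hZ ht).congr' ?_
    filter_upwards [eventually_ne_atTop 0] with n hn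
    have : √(n : ℝ) ≠ 0 := by positivity
    rw [mul_inv_cancel_left₀ this]
  have hmain := tendsto_integral_average hμ hlog hfm hfb hL0 hflim
  have hlimit : ∫ l, (1 / l * ∫ t in (0 : ℝ)..l, deriv u m * (σ * realQuantile P' Z t)) ∂μ =
      deriv u m * (σ * mixedUtility P' μ Z) := by
    simp only [mixedUtility, ← integral_const_mul]
    refine integral_congr_ae (ae_of_all _ fun l => ?_)
    change 1 / l * ∫ t in (0 : ℝ)..l, deriv u m * (σ * realQuantile P' Z t) =
      deriv u m * (σ * (1 / l * ∫ t in (0 : ℝ)..l, realQuantile P' Z t))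
    rw [intervalIntegral.integral_const_mul, intervalIntegral.integral_const_mul]
    ring
  rw [hlimit] at hmain
  refine hmain.congr' ?_
  filter_upwards [eventually_ne_atTop 0] with n hn
  have hr : 0 < √(n : ℝ) := by positivity
  simp only [mean_eq_add_normalizedSum (P := P) hn]
  exact (mul_mixedUtility_comp_sub hμ hu.continuous hu_mono (hYm n) m hr
    (integrableOn_of_le_log_envelope (hfm n) (hfb n))
    (integrable_average hμ hlog (hfm n) (hfb n) hL0)).symm

end Premium

end RiskPremium

theorem theorem1 {Ω Ω' : Type*} [MeasurableSpace Ω] [MeasurableSpace Ω']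
    (P : Measure Ω) [IsProbabilityMeasure P]
    -- the mixing measure on `(0, 1]`
    (μ : Measure ℝ) [IsProbabilityMeasure μ] (hμ : ∀ᵐ l ∂μ, l ∈ Set.Ioc (0 : ℝ) 1)
    (hlog : Integrable (fun l : ℝ => Real.log (1 / l)) μ)
    -- the utility function
    (u : ℝ → ℝ) (hu : ContDiff ℝ 1 u) (hu_mono : StrictMono u)
    (hu_inv : ContDiffOn ℝ 1 (Function.invFun u) (Set.range u))
    -- the risks; `X 0, X 1, …` are `X_1, X_2, …`
    (X : ℕ → Ω → ℝ) (hX_bdd : MemLp (X 0) ⊤ P) (hX_indep : iIndepFun X P)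
    (hX_ident : ∀ i, IdentDistrib (X i) (X 0) P P)
    -- a standard normal random variable, on any probability space (`Ω` itself included)
    (P' : Measure Ω') [IsProbabilityMeasure P'] (Z : Ω' → ℝ) (hZ : HasLaw Z (gaussianReal 0 1) P') :
    Tendsto
      (fun n : ℕ => Real.sqrt n * ((∫ ω, X 0 ω ∂P) -
        RiskPremium.certaintyEquivalent P μ u (fun ω => (∑ i ∈ Finset.range n, X i ω) / n)))
      atTop (𝓝 (-Real.sqrt (variance (X 0) P) * RiskPremium.mixedUtility P' μ Z)) ∧
    Integrable (fun l : ℝ => RiskPremium.avarUtility P' l Z) μ ∧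
    -Real.sqrt (variance (X 0) P) * RiskPremium.mixedUtility P' μ Z =
      -Real.sqrt (variance (X 0) P) * ∫ l, RiskPremium.avarUtility P' l Z ∂μ ∧
    Integrable
      (fun l : ℝ => 1 / l * RiskPremium.stdNormalPDF (RiskPremium.stdNormalInv l)) μ ∧
    -Real.sqrt (variance (X 0) P) * ∫ l, RiskPremium.avarUtility P' l Z ∂μ =
      Real.sqrt (variance (X 0) P) *
        ∫ l, 1 / l * RiskPremium.stdNormalPDF (RiskPremium.stdNormalInv l) ∂μ := by
  have hmean : Integrable (fun l : ℝ => RiskPremium.avarUtility P' l Z) μ :=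
    RiskPremium.integrable_avarUtility_normal hμ hlog hZ
  have hclosed : ∀ᵐ l ∂μ, RiskPremium.avarUtility P' l Z =
      -(1 / l * RiskPremium.stdNormalPDF (RiskPremium.stdNormalInv l)) := by
    filter_upwards [hμ] with l hl using RiskPremium.avarUtility_normal hZ hl
  refine ⟨?_, hmean, rfl, ?_, ?_⟩
  · set m : ℝ := ∫ ω, X 0 ω ∂P
    obtain ⟨hne, hinv⟩ :=
      RiskPremium.deriv_ne_zero_and_hasDerivAt_invFun hu hu_mono hu_inv m
    have h := RiskPremium.tendsto_sqrt_mul_sub hinv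
      (RiskPremium.tendsto_mixedUtility_mean hμ hlog hu hu_mono hX_bdd hX_indep hX_ident hZ)
    rw [inv_mul_cancel_left₀ hne] at h
    have h' := h.neg
    rw [← neg_mul] at h'
    refine h'.congr fun n => ?_
    rw [add_sub_cancel, Function.leftInverse_invFun hu_mono.injective m,
      RiskPremium.certaintyEquivalent]
    ring
  · refine hmean.neg.congr ?_
    filter_upwards [hclosed] with l hl
    simp [hl]
  · rw [integral_congr_ae hclosed, integral_neg]
    ring
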